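/- Consider unconstrained online linear optimization in $\mathbb{R}^d$, $d\ge 1$, with the Euclidean norm: in each round $t=1,2,\dots$ a deterministic algorithm predicts $x_t\in\mathbb{R}^d$ as a function of $g_1,\dots,g_{t-1}$, and then an adversary chooses a loss gradient $g_t\in\mathbb{R}^d$ with $\|g_t\|\le 1$ as a function of $x_1,\dots,x_t$. For $u\in\mathbb{R}^d$ and $T\ge 1$ the regret is $\mathrm{Regret}_T(u)=\sum_{t=1}^T\langle g_t,x_t\rangle-\sum_{t=1}^T\langle g_t,u\rangle$. **Theorem.** For all $C>0$, $\eta\in(0,1)$ and $U\ge 12\eta^{-1}C$ there exists a positive integer $T_0$, depending only on $\eta$, $U$ and $C$, such that the following holds. For every $d\ge1$, every $T\ge T_0$ and every algorithm in $\mathbb{R}^d$ that guarantees $\mathrm{Regret}_T(0)\le C\sqrt{e}$ against all adversaries, there exist an adversary and a comparator $u\in\mathbb{R}^d$ with $\|u\|=U$ such that, in the game between this algorithm and this adversary, $$\mathrm{Regret}_T(u)\;\ge\;\Bigl[1-\frac{\eta}{\log T}\Bigr]\,\|u\|\,\sqrt{2T\log\frac{\eta\|u\|\sqrt{T}}{2\sqrt{\pi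 e}\,C\log T}}.$$ -/

import Mathlib

namespace OLO

/-- The domain `ℝ^d` with the Euclidean norm. -/
abbrev Point (d : ℕ) : Type := EuclideanSpace ℝ (Fin d)

/-- The loss gradients available to the adversary: the closed Euclidean unit ball of `ℝ^d`. -/
abbrev Grad (d : ℕ) : Type := Metric.closedBall (0 : Point d) 1

/-- A deterministic unconstrained OLO algorithm. Rounds are indexed from `0`: in round `t` it
predicts a point as a function of the `t` gradients revealed in the earlier rounds. -/
abbrev Algorithm (d : ℕ) : Type := (t : ℕ) → (Fin t → Grad d) → Point d

/-- An adaptive adversary: in round `t` (from `0`) it chooses a gradient in the unit ball as a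
function of the `t + 1` predictions made so far, the current one included. -/
abbrev Adversary (d : ℕ) : Type := (t : ℕ) → (Fin (t + 1) → Point d) → Grad d

/-- The predictions and the gradients of the first `t` rounds of the game. -/
noncomputable def history {d : ℕ} (A : Algorithm d) (adv : Adversary d) :
    (t : ℕ) → (Fin t → Point d) × (Fin t → Grad d)
  | 0 => (Fin.elim0, Fin.elim0)
  | t + 1 =>
    let h := history A adv t
    let xs : Fin (t + 1) → Point d := Fin.snoc h.1 (A t h.2)
    (xs, Fin.snoc h.2 (adv t xs))

/-- The prediction of the algorithm in round `t` (from `0`). -/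
noncomputable def prediction {d : ℕ} (A : Algorithm d) (adv : Adversary d) (t : ℕ) : Point d :=
  (history A adv (t + 1)).1 (Fin.last t)

/-- The gradient chosen by the adversary in round `t` (from `0`). -/
noncomputable def gradient {d : ℕ} (A : Algorithm d) (adv : Adversary d) (t : ℕ) : Grad d :=
  (history A adv (t + 1)).2 (Fin.last t)

theorem history_eq {d : ℕ} (A : Algorithm d) (adv : Adversary d) (t : ℕ) :
    history A adv t = (fun i : Fin t => prediction A adv i, fun i : Fin t => gradient A adv i) := by
  induction t with
  | zero => ext i <;> exact i.elim0
  | succ t ih =>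
    refine Prod.ext (funext fun i => ?_) (funext fun i => ?_) <;>
    · refine Fin.lastCases ?_ (fun j => ?_) i
      · rfl
      · simp only [history, Fin.snoc_castSucc]
        rw [ih]
        rfl

/-- The predictions obey the algorithm. -/
theorem prediction_eq {d : ℕ} (A : Algorithm d) (adv : Adversary d) (t : ℕ) :
    prediction A adv t = A t (fun i : Fin t => gradient A adv i) := by
  have h : prediction A adv t = A t (history A adv t).2 := by
    simp [prediction, history]
  rw [h, history_eq]

/-- The gradients obey the adversary. -/
theorem gradient_eq {d : ℕ} (A : Algorithm d) (adv : Adversary d) (t : ℕ) :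
    gradient A adv t = adv t (fun i : Fin (t + 1) => prediction A adv i) := by
  have h : gradient A adv t = adv t (history A adv (t + 1)).1 := by
    simp [gradient, history]
  rw [h, history_eq]

/-- The regret `∑ ⟨g_t, x_t⟩ - ∑ ⟨g_t, u⟩` over the first `T` rounds of the game between `A` and
`adv`, with respect to the comparator `u`. -/
noncomputable def regret {d : ℕ} (A : Algorithm d) (adv : Adversary d) (T : ℕ) (u : Point d) : ℝ :=
  ∑ t ∈ Finset.range T, inner ℝ (gradient A adv t : Point d) (prediction A adv t)
    - ∑ t ∈ Finset.range T, inner ℝ (gradient A adv t : Point d) u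

end OLO

/-!
Against gradients that are independent random signs times a fixed unit vector every algorithm has
expected loss zero, and for the best `u` with `‖u‖ = U` the expected regret is `U` times the mean
absolute endpoint `|S|` of a simple random walk. More is true if the loss `Regret_T(0)` never
exceeds `ε`: if no sign sequence forces regret above `R + ε`, then the loss is at most
`ε - max (U |S| - R) 0` on every sequence, and averaging bounds the expected excess of `U |S|` over
`R` by `ε`.

The expected excess is at least its part from a window of length `√(T / log T)` beyond `R / (2 U)`,
where the binomial weights are still comparable to that at the start of the window. They are bounded
below through `4 ^ n ≤ 2 √n * C(2 n, n)` and `C(2 n, n + m) ≥ C(2 n, n) * exp (-m ^ 2 / (n - m))`.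
For `R = U √(2 T log (κ √T / log T))` the resulting bound tends to the positive constant
`√2 U / (κ e ^ 2)`, so the theorem reduces to an inequality between constants. The factor
`1 - η / log T` changes `2 T log (…)` by about `2 T η` and hence allows `κ` to be replaced by
`κ e ^ (-α)` for any `α < η`.
-/

theorem four_pow_le_two_sqrt_mul_centralBinom {n : ℕ} (hn : 1 ≤ n) :
    (4 : ℝ) ^ n ≤ 2 * √n * n.centralBinom := by
  induction n, hn using Nat.le_induction with
  | base => norm_num [Nat.centralBinom, Nat.choose]
  | succ n hn ih =>
    have hrec : ((n : ℝ) + 1) * (n + 1).centralBinom = 2 * (2 * n + 1) * n.centralBinom := by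
      exact_mod_cast Nat.succ_mul_centralBinom_succ n
    have hsq : √((n : ℝ) + 1) * √((n : ℝ) + 1) = n + 1 := Real.mul_self_sqrt (by positivity)
    have hamgm : 2 * √n * √((n : ℝ) + 1) ≤ 2 * n + 1 := by
      linarith [two_mul_le_add_sq √(n : ℝ) √((n : ℝ) + 1), Real.sq_sqrt (n.cast_nonneg (α := ℝ))]
    push_cast
    refine le_of_mul_le_mul_left ?_ (show 0 < √((n : ℝ) + 1) by positivity)
    calc √((n : ℝ) + 1) * 4 ^ (n + 1) = 4 * √((n : ℝ) + 1) * 4 ^ n := by ring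
      _ ≤ 4 * √((n : ℝ) + 1) * (2 * √n * n.centralBinom) := by gcongr
      _ = 4 * (2 * √n * √((n : ℝ) + 1)) * n.centralBinom := by ring
      _ ≤ 4 * (2 * n + 1) * n.centralBinom := by gcongr
      _ = 2 * (((n : ℝ) + 1) * (n + 1).centralBinom) := by rw [hrec]; ring
      _ = √((n : ℝ) + 1) * (2 * √((n : ℝ) + 1) * (n + 1).centralBinom) := by
        linear_combination (-2 * ((n + 1).centralBinom : ℝ)) * hsq

theorem choose_two_mul_add_succ_mul (n m : ℕ) :
    (2 * n).choose (n + (m + 1)) * (n + m + 1) = (2 * n).choose (n + m) * (n - m) := by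
  rw [← add_assoc, Nat.choose_succ_right_eq, show 2 * n - (n + m) = n - m by omega]

theorem antitone_choose_two_mul_add (n : ℕ) : Antitone fun m => (2 * n).choose (n + m) :=
  antitone_nat_of_succ_le fun m => by
    refine Nat.le_of_mul_le_mul_right ?_ (Nat.succ_pos (n + m))
    rw [choose_two_mul_add_succ_mul]
    exact Nat.mul_le_mul_left _ (by omega)

theorem centralBinom_mul_exp_le_choose {n m : ℕ} {D : ℝ} (hD : 0 < D) (hm : m + D ≤ n) :
    n.centralBinom * Real.exp (-((m : ℝ) ^ 2 / D)) ≤ ((2 * n).choose (n + m) : ℝ) := by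
  induction m with
  | zero => simp [Nat.centralBinom]
  | succ m ih =>
    push_cast at hm ⊢
    have hrec : ((2 * n).choose (n + (m + 1)) : ℝ) * (n + m + 1) =
        (2 * n).choose (n + m) * (n - m) := by
      have hmn : m ≤ n := by exact_mod_cast (by linarith : (m : ℝ) ≤ n)
      rw [← Nat.cast_sub hmn]
      exact_mod_cast choose_two_mul_add_succ_mul n m
    have hratio : (n + m + 1 : ℝ) ≤ Real.exp ((2 * m + 1) / D) * (n - m) :=
      calc (n + m + 1 : ℝ) ≤ ((2 * m + 1) / D + 1) * (n - m) := by
            have : (2 * m + 1 : ℝ) ≤ (2 * m + 1) / D * (n - m) := by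
              rw [div_mul_eq_mul_div, le_div_iff₀ hD]
              gcongr
              linarith
            linarith
        _ ≤ Real.exp ((2 * m + 1) / D) * (n - m) := by
            gcongr
            · linarith
            · exact Real.add_one_le_exp _
    have hexp : Real.exp (-((m + 1 : ℝ) ^ 2 / D)) * Real.exp ((2 * m + 1) / D) =
        Real.exp (-((m : ℝ) ^ 2 / D)) := by
      rw [← Real.exp_add]
      ring_nf
    refine le_of_mul_le_mul_right ?_ (show (0 : ℝ) < n + m + 1 by positivity)
    calc n.centralBinom * Real.exp (-((m + 1 : ℝ) ^ 2 / D)) * (n + m + 1)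
        ≤ n.centralBinom * Real.exp (-((m + 1 : ℝ) ^ 2 / D)) *
            (Real.exp ((2 * m + 1) / D) * (n - m)) := by gcongr
      _ = n.centralBinom * Real.exp (-((m : ℝ) ^ 2 / D)) * (n - m) := by rw [← hexp]; ring
      _ ≤ (2 * n).choose (n + m) * (n - m) := by
          gcongr
          · linarith
          · exact ih (by linarith)
      _ = _ := hrec.symm

theorem four_pow_mul_exp_le_choose {n m : ℕ} (hmn : m < n) :
    (4 : ℝ) ^ n * Real.exp (-((m : ℝ) ^ 2 / (n - m))) ≤ 2 * √n * (2 * n).choose (n + m) := by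
  have hD : (0 : ℝ) < n - m := sub_pos.2 (by exact_mod_cast hmn)
  calc (4 : ℝ) ^ n * Real.exp (-((m : ℝ) ^ 2 / (n - m)))
      ≤ 2 * √n * n.centralBinom * Real.exp (-((m : ℝ) ^ 2 / (n - m))) := by
        gcongr
        exact four_pow_le_two_sqrt_mul_centralBinom (by omega)
    _ ≤ 2 * √n * (2 * n).choose (n + m) := by
        rw [mul_assoc]
        gcongr
        exact centralBinom_mul_exp_le_choose hD (by linarith)

theorem sum_range_two_mul_add_one_eq_add_sum {M : Type*} [AddCommMonoid M] (f : ℕ → M) (n : ℕ) :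
    ∑ k ∈ Finset.range (2 * n + 1), f k =
      f n + ∑ j ∈ Finset.range n, (f (n + (j + 1)) + f (n - (j + 1))) := by
  have hleft : ∑ k ∈ Finset.range n, f k = ∑ j ∈ Finset.range n, f (n - (j + 1)) := by
    rw [← Finset.sum_range_reflect]
    simp only [Nat.sub_sub, add_comm 1]
  rw [show 2 * n + 1 = n + (n + 1) by ring, Finset.sum_range_add, Finset.sum_range_succ',
    Finset.sum_add_distrib, hleft, add_zero]
  abel

theorem sum_range_two_mul_succ (N : ℕ) :
    ∑ j ∈ Finset.range N, (2 * ((j : ℝ) + 1)) = N * (N + 1) := by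
  induction N with
  | zero => simp
  | succ N ih => rw [Finset.sum_range_succ, ih]; push_cast; ring

/-- The number of sign sequences of length `m`, weighted by the excess of `U |S|` over `R`, where
`S` is the sum of the sequence: `2 ^ m` times the expected excess for a simple random walk. The
summation index is the number of positive signs. -/
noncomputable def walkExcess (m : ℕ) (U R : ℝ) : ℝ :=
  ∑ k ∈ Finset.range (m + 1), (m.choose k : ℝ) * max (U * |2 * (k : ℝ) - m| - R) 0

theorem walkExcess_two_mul_eq {n : ℕ} (U R : ℝ) :
    walkExcess (2 * n) U R = n.centralBinom * max (-R) 0 + 2 * ∑ j ∈ Finset.range n,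
      ((2 * n).choose (n + (j + 1)) : ℝ) * max (U * (2 * (j + 1)) - R) 0 := by
  rw [walkExcess, sum_range_two_mul_add_one_eq_add_sum, Finset.mul_sum]
  congr 1
  · simp [Nat.centralBinom]
  refine Finset.sum_congr rfl fun j hj => ?_
  have hjn : j + 1 ≤ n := Finset.mem_range.1 hj
  have hup : |2 * ((n + (j + 1) : ℕ) : ℝ) - (2 * n : ℕ)| = 2 * (j + 1) := by
    rw [abs_of_nonneg] <;> push_cast <;> linarith [j.cast_nonneg (α := ℝ)]
  have hdown : |2 * ((n - (j + 1) : ℕ) : ℝ) - (2 * n : ℕ)| = 2 * (j + 1) := by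
    rw [abs_of_nonpos] <;> push_cast [hjn] <;> linarith [j.cast_nonneg (α := ℝ)]
  rw [hup, hdown, Nat.choose_symm_of_eq_add (show 2 * n = n - (j + 1) + (n + (j + 1)) by omega)]
  ring

theorem two_mul_sq_mul_choose_le_walkExcess {n K N : ℕ} (hKN : K + N ≤ n) {U R : ℝ} (hU : 0 ≤ U)
    (hR : R ≤ U * (2 * K)) :
    2 * U * (N : ℝ) ^ 2 * (2 * n).choose (n + (K + N)) ≤ walkExcess (2 * n) U R := by
  set c := ((2 * n).choose (n + (K + N)) : ℝ)
  set f : ℕ → ℝ := fun j => ((2 * n).choose (n + (j + 1)) : ℕ) * max (U * (2 * (j + 1)) - R) 0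
  have hterm : ∀ i ∈ Finset.range N, c * (U * (2 * (i + 1))) ≤ f (K + i) := by
    intro i hi
    have hiN : i < N := Finset.mem_range.1 hi
    refine mul_le_mul ?_ (le_max_of_le_left ?_) (by positivity) (by positivity)
    · exact Nat.cast_le.2 (antitone_choose_two_mul_add n (by omega : K + i + 1 ≤ K + N))
    · push_cast
      linarith
  have hwindow : c * (U * N ^ 2) ≤ ∑ j ∈ Finset.range n, f j :=
    calc c * (U * N ^ 2) ≤ c * (U * (N * (N + 1))) := by gcongr; nlinarith [N.cast_nonneg (α := ℝ)]
      _ = ∑ i ∈ Finset.range N, c * (U * (2 * (i + 1))) := by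
          rw [← sum_range_two_mul_succ, Finset.mul_sum, Finset.mul_sum]
      _ ≤ ∑ i ∈ Finset.range N, f (K + i) := Finset.sum_le_sum hterm
      _ ≤ ∑ j ∈ Finset.range (K + N), f j := by
          rw [Finset.sum_range_add]
          exact le_add_of_nonneg_left (Finset.sum_nonneg fun j _ => by positivity)
      _ ≤ ∑ j ∈ Finset.range n, f j :=
          Finset.sum_le_sum_of_subset_of_nonneg (Finset.range_mono hKN) fun j _ _ => by positivity
  have hcentre : 0 ≤ (n.centralBinom : ℝ) * max (-R) 0 := by positivity
  rw [walkExcess_two_mul_eq]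
  linarith

namespace OLO

variable {d : ℕ}

/-- The adversary that plays a gradient sequence fixed in advance. -/
def obliviousAdversary (g : ℕ → Grad d) : Adversary d := fun t _ => g t

theorem gradient_obliviousAdversary (A : Algorithm d) (g : ℕ → Grad d) (t : ℕ) :
    gradient A (obliviousAdversary g) t = g t := by
  rw [gradient_eq, obliviousAdversary]

theorem prediction_obliviousAdversary (A : Algorithm d) (g : ℕ → Grad d) (t : ℕ) :
    prediction A (obliviousAdversary g) t = A t fun i => g i := by
  simp only [prediction_eq, gradient_obliviousAdversary]

theorem regret_zero (A : Algorithm d) (adv : Adversary d) (T : ℕ) :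
    regret A adv T 0 =
      ∑ t ∈ Finset.range T, inner ℝ (gradient A adv t : Point d) (prediction A adv t) := by
  simp [regret]

/-- Step `t` of the walk with `m` steps whose positive steps are the elements of `σ`. The walk
stands still from time `m` on. -/
noncomputable def walkStep (m : ℕ) (σ : Finset ℕ) (t : ℕ) : ℝ :=
  if t < m then if t ∈ σ then 1 else -1 else 0

theorem abs_walkStep_le_one (m : ℕ) (σ : Finset ℕ) (t : ℕ) : |walkStep m σ t| ≤ 1 := by
  unfold walkStep
  split_ifs <;> simp

theorem walkStep_symmDiff_singleton_self (m : ℕ) (σ : Finset ℕ) (t : ℕ) :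
    walkStep m (symmDiff σ {t}) t = -walkStep m σ t := by
  by_cases h : t ∈ σ <;> simp [walkStep, Finset.mem_symmDiff, h, apply_ite]

theorem walkStep_symmDiff_singleton_of_ne (m : ℕ) (σ : Finset ℕ) {s t : ℕ} (hst : s ≠ t) :
    walkStep m (symmDiff σ {t}) s = walkStep m σ s := by
  simp [walkStep, Finset.mem_symmDiff, hst]

theorem sum_walkStep {m T : ℕ} (hm : m ≤ T) {σ : Finset ℕ} (hσ : σ ⊆ Finset.range m) :
    ∑ t ∈ Finset.range T, walkStep m σ t = 2 * (σ.card : ℝ) - m := by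
  have hstep : ∀ t ∈ Finset.range m, walkStep m σ t = 2 * (if t ∈ σ then 1 else 0) - 1 := by
    intro t ht
    rw [walkStep, if_pos (Finset.mem_range.1 ht)]
    split_ifs <;> norm_num
  have hrest : ∀ t ∈ Finset.range T, t ∉ Finset.range m → walkStep m σ t = 0 :=
    fun t _ ht => if_neg (by simpa using ht)
  rw [← Finset.sum_subset (Finset.range_mono hm) hrest, Finset.sum_congr rfl hstep,
    Finset.sum_sub_distrib, ← Finset.mul_sum, Finset.sum_ite_mem, Finset.inter_eq_right.2 hσ]
  simp

/-- The oblivious adversary whose gradients are the steps of a walk along the line through `e`. -/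
noncomputable def walkAdversary (e : Grad d) (m : ℕ) (σ : Finset ℕ) : Adversary d :=
  obliviousAdversary fun t => ⟨walkStep m σ t • (e : Point d), by
    rw [mem_closedBall_zero_iff, norm_smul, Real.norm_eq_abs]
    exact mul_le_one₀ (abs_walkStep_le_one m σ t) (norm_nonneg _) (mem_closedBall_zero_iff.1 e.2)⟩

theorem regret_walkAdversary (A : Algorithm d) {e : Grad d} (he : ‖(e : Point d)‖ = 1) {m T : ℕ}
    (hm : m ≤ T) {σ : Finset ℕ} (hσ : σ ⊆ Finset.range m) (c : ℝ) :
    regret A (walkAdversary e m σ) T (c • (e : Point d)) =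
      regret A (walkAdversary e m σ) T 0 - c * (2 * (σ.card : ℝ) - m) := by
  rw [regret_zero, regret, ← sum_walkStep hm hσ, Finset.mul_sum]
  simp [walkAdversary, gradient_obliviousAdversary, inner_smul_left, inner_smul_right, he]

/-- Flipping the sign of step `t` flips the loss of round `t`, because the prediction of that round
depends only on the earlier steps. -/
theorem sum_powerset_loss_walkAdversary (A : Algorithm d) (e : Grad d) (m t : ℕ) :
    ∑ σ ∈ (Finset.range m).powerset,
      inner ℝ (gradient A (walkAdversary e m σ) t : Point d)
        (prediction A (walkAdversary e m σ) t) = 0 := by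
  simp only [walkAdversary, gradient_obliviousAdversary, prediction_obliviousAdversary]
  by_cases ht : t < m
  · refine Finset.sum_involution (fun σ _ => symmDiff σ {t}) (fun σ _ => ?_) (fun σ _ _ => ?_)
      (fun σ hσ => ?_) (fun σ _ => symmDiff_symmDiff_cancel_right _ _)
    · have hpast (i : Fin t) : walkStep m (symmDiff σ {t}) i = walkStep m σ i :=
        walkStep_symmDiff_singleton_of_ne m σ i.2.ne
      simp only [hpast, walkStep_symmDiff_singleton_self, neg_smul, inner_neg_left, add_neg_cancel]
    · simp [symmDiff_eq_left]
    · rw [Finset.mem_powerset] at hσ ⊢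
      exact symmDiff_le_sup.trans (sup_le hσ (by simpa using ht))
  · simp [walkStep, ht]

theorem sum_powerset_regret_zero_walkAdversary (A : Algorithm d) (e : Grad d) (m T : ℕ) :
    ∑ σ ∈ (Finset.range m).powerset, regret A (walkAdversary e m σ) T 0 = 0 := by
  simp only [regret_zero]
  rw [Finset.sum_comm]
  exact Finset.sum_eq_zero fun t _ => sum_powerset_loss_walkAdversary A e m t

theorem sum_powerset_excess_eq_walkExcess (m : ℕ) (U R : ℝ) :
    ∑ σ ∈ (Finset.range m).powerset, max (U * |2 * (σ.card : ℝ) - m| - R) 0 =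
      walkExcess m U R := by
  rw [Finset.sum_powerset_apply_card fun k => max (U * |2 * (k : ℝ) - m| - R) 0]
  simp only [Finset.card_range, nsmul_eq_mul, walkExcess]

theorem exists_regret_gt_of_lt_walkExcess (A : Algorithm d) {e : Grad d}
    (he : ‖(e : Point d)‖ = 1) {m T : ℕ} (hm : m ≤ T) {U R ε : ℝ} (hU : 0 ≤ U)
    (hA : ∀ adv : Adversary d, regret A adv T 0 ≤ ε) (hexc : 2 ^ m * ε < walkExcess m U R) :
    ∃ (adv : Adversary d) (u : Point d), ‖u‖ = U ∧ R + ε < regret A adv T u := by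
  obtain ⟨σ, hσ, hlt⟩ : ∃ σ ∈ (Finset.range m).powerset,
      ε - max (U * |2 * (σ.card : ℝ) - m| - R) 0 < regret A (walkAdversary e m σ) T 0 := by
    apply Finset.exists_lt_of_sum_lt
    rw [sum_powerset_regret_zero_walkAdversary, Finset.sum_sub_distrib,
      sum_powerset_excess_eq_walkExcess]
    simpa using hexc
  set S : ℝ := 2 * (σ.card : ℝ) - m with hS
  have hpos : 0 < max (U * |S| - R) 0 := by linarith [hA (walkAdversary e m σ)]
  rw [max_eq_left_of_lt ((lt_max_iff.1 hpos).resolve_right (lt_irrefl 0))] at hlt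
  obtain ⟨c, hc, hcS⟩ : ∃ c : ℝ, |c| = U ∧ c * S = -(U * |S|) := by
    rcases abs_choice S with h | h
    · exact ⟨-U, by rw [abs_neg, abs_of_nonneg hU], by rw [h, neg_mul]⟩
    · exact ⟨U, abs_of_nonneg hU, by rw [h, mul_neg, neg_neg]⟩
  refine ⟨walkAdversary e m σ, c • (e : Point d), by rw [norm_smul, he, mul_one, ← hc]; rfl, ?_⟩
  rw [regret_walkAdversary A he hm (Finset.mem_powerset.1 hσ), ← hS, hcS]
  linarith

theorem exists_regret_gt_of_lt_window (hd : 0 < d) (A : Algorithm d) {n K N T : ℕ}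
    (hn : 2 * n ≤ T) (hKN : K + N < n) {U R ε : ℝ} (hU : 0 ≤ U) (hR : R ≤ U * (2 * K))
    (hA : ∀ adv : Adversary d, regret A adv T 0 ≤ ε)
    (hε : ε < U * ((N : ℝ) ^ 2 / √n) *
      Real.exp (-(((K + N : ℕ) : ℝ) ^ 2 / (n - (K + N : ℕ))))) :
    ∃ (adv : Adversary d) (u : Point d), ‖u‖ = U ∧ R + ε < regret A adv T u := by
  have hn0 : 0 < √(n : ℝ) := Real.sqrt_pos.2 (by exact_mod_cast (by omega : 0 < n))
  let e : Grad d := ⟨EuclideanSpace.single ⟨0, hd⟩ 1, by simp⟩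
  refine exists_regret_gt_of_lt_walkExcess A (e := e) (by simp [e]) hn hU hA ?_
  calc 2 ^ (2 * n) * ε = 4 ^ n * ε := by rw [pow_mul]; norm_num
    _ < 4 ^ n * (U * ((N : ℝ) ^ 2 / √n) *
          Real.exp (-(((K + N : ℕ) : ℝ) ^ 2 / (n - (K + N : ℕ))))) := by gcongr
    _ = U * ((N : ℝ) ^ 2 / √n) *
          (4 ^ n * Real.exp (-(((K + N : ℕ) : ℝ) ^ 2 / (n - (K + N : ℕ))))) := by ring
    _ ≤ U * ((N : ℝ) ^ 2 / √n) * (2 * √n * (2 * n).choose (n + (K + N))) := by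
        gcongr U * (_ / _) * ?_
        exact four_pow_mul_exp_le_choose hKN
    _ = 2 * U * (N : ℝ) ^ 2 * (2 * n).choose (n + (K + N)) := by field_simp
    _ ≤ walkExcess (2 * n) U R := two_mul_sq_mul_choose_le_walkExcess hKN.le hU hR

end OLO

open Filter Topology

theorem tendsto_log_natCast_atTop : Tendsto (fun T : ℕ => Real.log T) atTop atTop :=
  Real.tendsto_log_atTop.comp tendsto_natCast_atTop_atTop

theorem tendsto_log_natCast_pow_div (k : ℕ) :
    Tendsto (fun T : ℕ => Real.log T ^ k / T) atTop (𝓝 0) :=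
  Real.isLittleO_pow_log_id_atTop.tendsto_div_nhds_zero.comp tendsto_natCast_atTop_atTop

theorem tendsto_sqrt_div_log_natCast_atTop :
    Tendsto (fun T : ℕ => √(T / Real.log T)) atTop atTop := by
  refine Real.tendsto_sqrt_atTop.comp ?_
  have hpos : ∀ᶠ T : ℕ in atTop, 0 < Real.log T ^ 1 / T := by
    filter_upwards [tendsto_log_natCast_atTop.eventually_gt_atTop 0, eventually_gt_atTop 0]
      with T hlog hT
    positivity
  refine (tendsto_nhdsWithin_iff.2
    ⟨tendsto_log_natCast_pow_div 1, hpos⟩).inv_tendsto_nhdsGT_zero.congr fun T => ?_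
  rw [Pi.inv_apply, pow_one, inv_div]

theorem tendsto_natCast_div_half : Tendsto (fun T : ℕ => (T : ℝ) / (T / 2 : ℕ)) atTop (𝓝 2) := by
  have h := ((tendsto_nat_floor_mul_div_atTop (R := ℝ) (a := 1 / 2) (by norm_num)).comp
    tendsto_natCast_atTop_atTop).inv₀ (by norm_num)
  rw [one_div, inv_inv] at h
  refine h.congr fun T => ?_
  rw [Function.comp_apply, inv_div, ← Nat.floor_div_eq_div (K := ℝ) T 2, inv_mul_eq_div]
  norm_num

/-- The logarithm in the lower bound, with `κ` collecting all constants. -/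
noncomputable def logFactor (κ : ℝ) (T : ℕ) : ℝ :=
  Real.log (κ * √T / Real.log T)

theorem exp_logFactor {κ : ℝ} (hκ : 0 < κ) {T : ℕ} (hT : 0 < T) (hlog : 0 < Real.log T) :
    Real.exp (logFactor κ T) = κ * √T / Real.log T :=
  Real.exp_log (by positivity)

theorem tendsto_logFactor_div_log {κ : ℝ} (hκ : 0 < κ) :
    Tendsto (fun T : ℕ => logFactor κ T / Real.log T) atTop (𝓝 (1 / 2)) := by
  have hlog := tendsto_log_natCast_atTop
  have hloglog : Tendsto (fun T : ℕ => Real.log (Real.log T) / Real.log T) atTop (𝓝 0) :=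
    Real.isLittleO_log_id_atTop.tendsto_div_nhds_zero.comp hlog
  have h := ((hlog.const_div_atTop (Real.log κ)).add_const (1 / 2)).sub hloglog
  rw [zero_add, sub_zero] at h
  refine h.congr' ?_
  filter_upwards [hlog.eventually_gt_atTop 0, eventually_gt_atTop 0] with T hlogT hT
  rw [logFactor, Real.log_div (by positivity) hlogT.ne', Real.log_mul hκ.ne' (by positivity),
    Real.log_sqrt T.cast_nonneg]
  field_simp

theorem eventually_logFactor_pos {κ : ℝ} (hκ : 0 < κ) : ∀ᶠ T : ℕ in atTop, 0 < logFactor κ T := by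
  filter_upwards [tendsto_log_natCast_atTop.eventually_gt_atTop 0,
    (tendsto_logFactor_div_log hκ).eventually_const_lt one_half_pos] with T hlog h
  exact (div_pos_iff_of_pos_right hlog).1 h

/-- Half the distance `√(2 T log (…))` from the origin at which the walk starts to have an excess:
a walk of `2 n` steps with `n + j` positive ones ends at `2 j`. -/
noncomputable def windowStart (κ : ℝ) (T : ℕ) : ℕ :=
  ⌈√(T * logFactor κ T / 2)⌉₊

/-- The number of positions beyond `windowStart` over which the excess is collected, chosen as
`√(T / log T)` because this is the scale on which the binomial weights decay there. -/
noncomputable def windowLength (T : ℕ) : ℕ :=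
  ⌊√(T / Real.log T)⌋₊

/-- The last position of the window, where the binomial weight is smallest. -/
noncomputable def windowEnd (κ : ℝ) (T : ℕ) : ℕ :=
  windowStart κ T + windowLength T

theorem sqrt_two_mul_logFactor_le (κ : ℝ) (T : ℕ) :
    √(2 * T * logFactor κ T) ≤ 2 * windowStart κ T :=
  calc √(2 * T * logFactor κ T) = √(2 ^ 2 * (T * logFactor κ T / 2)) := by ring_nf
    _ = 2 * √(T * logFactor κ T / 2) := by
        rw [Real.sqrt_mul (by norm_num), Real.sqrt_sq (by norm_num)]
    _ ≤ 2 * windowStart κ T := by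
        gcongr
        exact Nat.le_ceil _

theorem tendsto_windowLength_div :
    Tendsto (fun T : ℕ => windowLength T / √(T / Real.log T)) atTop (𝓝 1) :=
  tendsto_nat_floor_div_atTop.comp tendsto_sqrt_div_log_natCast_atTop

theorem tendsto_windowEnd_sub_div (κ : ℝ) :
    Tendsto (fun T : ℕ => (windowEnd κ T - √(T * logFactor κ T / 2)) / √(T / Real.log T)) atTop
      (𝓝 1) := by
  have hround : Tendsto (fun T : ℕ => (windowStart κ T - √(T * logFactor κ T / 2)) /
      √(T / Real.log T)) atTop (𝓝 0) :=
    tendsto_bdd_div_atTop_nhds_zero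
      (.of_forall fun T => sub_nonneg.2 (Nat.le_ceil _))
      (.of_forall fun T => sub_le_iff_le_add'.2 (Nat.ceil_lt_add_one (Real.sqrt_nonneg _)).le)
      tendsto_sqrt_div_log_natCast_atTop
  have h := hround.add tendsto_windowLength_div
  rw [zero_add] at h
  refine h.congr fun T => ?_
  rw [windowEnd, Nat.cast_add]
  ring

theorem tendsto_windowEnd_sq_sub_div {κ : ℝ} (hκ : 0 < κ) :
    Tendsto (fun T : ℕ => ((windowEnd κ T : ℝ) ^ 2 - T * logFactor κ T / 2) / T) atTop (𝓝 1) := by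
  have hlog := tendsto_log_natCast_atTop
  have hδ := tendsto_windowEnd_sub_div κ
  -- If `M = a + δ √(T / log T)` with `a ^ 2 = T L / 2`, then
  -- `(M ^ 2 - a ^ 2) / T = 2 √(L / (2 log T)) δ + δ ^ 2 / log T`.
  have h := (((tendsto_logFactor_div_log hκ).div_const 2).sqrt.const_mul 2 |>.mul hδ).add
    ((hδ.pow 2).mul hlog.inv_tendsto_atTop)
  have hlim : 2 * √(1 / 2 / 2 : ℝ) * 1 + 1 ^ 2 * 0 = 1 := by
    rw [show (1 / 2 / 2 : ℝ) = (1 / 2) ^ 2 by norm_num, Real.sqrt_sq (by norm_num)]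
    norm_num
  rw [hlim] at h
  refine h.congr' ?_
  filter_upwards [hlog.eventually_gt_atTop 0, eventually_gt_atTop 0, eventually_logFactor_pos hκ]
    with T hlogT hT hL
  have hT' : (0 : ℝ) < T := by exact_mod_cast hT
  rw [Pi.inv_apply, div_right_comm, Real.sqrt_div (x := logFactor κ T / 2) (by positivity),
    Real.sqrt_div T.cast_nonneg, mul_div_assoc, Real.sqrt_mul T.cast_nonneg]
  have hr : 0 < √(Real.log T) := Real.sqrt_pos.2 hlogT
  have hs : 0 < √(T : ℝ) := Real.sqrt_pos.2 hT'
  set r := √(Real.log T)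
  set s := √(T : ℝ)
  set p := √(logFactor κ T / 2)
  have hp2 : logFactor κ T / 2 = p ^ 2 := (Real.sq_sqrt (by positivity)).symm
  have hr2 : Real.log T = r ^ 2 := (Real.sq_sqrt hlogT.le).symm
  have hs2 : (T : ℝ) = s ^ 2 := (Real.sq_sqrt hT'.le).symm
  rw [hp2, hr2, hs2]
  field_simp
  ring

theorem tendsto_mod_two_mul_of_tendsto_zero {f : ℕ → ℝ} (hf : Tendsto f atTop (𝓝 0)) :
    Tendsto (fun T : ℕ => ((T % 2 : ℕ) : ℝ) * f T) atTop (𝓝 0) :=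
  bdd_le_mul_tendsto_zero' 1 (.of_forall fun T => by
    rw [Nat.abs_cast]
    exact_mod_cast Nat.le_of_lt_succ (T.mod_lt two_pos)) hf

theorem tendsto_logFactor_div_half {κ : ℝ} (hκ : 0 < κ) :
    Tendsto (fun T : ℕ => logFactor κ T / (T / 2 : ℕ)) atTop (𝓝 0) := by
  have h := ((tendsto_logFactor_div_log hκ).mul (tendsto_log_natCast_pow_div 1)).mul
    tendsto_natCast_div_half
  rw [mul_zero, zero_mul] at h
  refine h.congr' ?_
  filter_upwards [tendsto_log_natCast_atTop.eventually_gt_atTop 0, eventually_gt_atTop 0]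
    with T hlog hT
  field_simp

theorem tendsto_windowEnd_sq_div_half_sub {κ : ℝ} (hκ : 0 < κ) :
    Tendsto (fun T : ℕ => (windowEnd κ T : ℝ) ^ 2 / (T / 2 : ℕ) - logFactor κ T) atTop (𝓝 2) := by
  have h := ((tendsto_windowEnd_sq_sub_div hκ).mul tendsto_natCast_div_half).add
    (tendsto_mod_two_mul_of_tendsto_zero (tendsto_logFactor_div_half hκ) |>.div_const 2)
  rw [one_mul, zero_div, add_zero] at h
  refine h.congr' ?_
  filter_upwards [eventually_ge_atTop 2] with T hT
  have hT0 : (T : ℝ) ≠ 0 := by positivity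
  have hn0 : ((T / 2 : ℕ) : ℝ) ≠ 0 := by exact_mod_cast (by omega : T / 2 ≠ 0)
  have hmod : (T : ℝ) = 2 * (T / 2 : ℕ) + (T % 2 : ℕ) := by exact_mod_cast (T.div_add_mod 2).symm
  field_simp
  linear_combination (-logFactor κ T) * hmod

theorem tendsto_windowEnd_sq_div_half_pow_div_half {κ : ℝ} (hκ : 0 < κ) (k : ℕ) :
    Tendsto (fun T : ℕ => ((windowEnd κ T : ℝ) ^ 2 / (T / 2 : ℕ)) ^ k / (T / 2 : ℕ)) atTop
      (𝓝 0) := by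
  have hlog := tendsto_log_natCast_atTop
  have h := ((((tendsto_windowEnd_sq_div_half_sub hκ).mul hlog.inv_tendsto_atTop).add
    (tendsto_logFactor_div_log hκ)).pow k).mul
    ((tendsto_log_natCast_pow_div k).mul tendsto_natCast_div_half)
  rw [zero_mul, mul_zero] at h
  refine h.congr' ?_
  filter_upwards [hlog.eventually_gt_atTop 0, eventually_ge_atTop 2] with T hlogT hT
  have hT0 : (T : ℝ) ≠ 0 := by positivity
  rw [Pi.inv_apply, ← div_eq_mul_inv, ← add_div, sub_add_cancel, div_pow]
  field_simp

theorem tendsto_windowEnd_div_half {κ : ℝ} (hκ : 0 < κ) :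
    Tendsto (fun T : ℕ => (windowEnd κ T : ℝ) / (T / 2 : ℕ)) atTop (𝓝 0) := by
  have h := (tendsto_windowEnd_sq_div_half_pow_div_half hκ 1).sqrt
  rw [Real.sqrt_zero] at h
  refine h.congr fun T => ?_
  rw [pow_one, div_div, ← sq, ← div_pow, Real.sqrt_sq (by positivity)]

theorem tendsto_windowEnd_pow_three_div_half_sq {κ : ℝ} (hκ : 0 < κ) :
    Tendsto (fun T : ℕ => (windowEnd κ T : ℝ) ^ 3 / ((T / 2 : ℕ) : ℝ) ^ 2) atTop (𝓝 0) := by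
  have h := (tendsto_windowEnd_sq_div_half_pow_div_half hκ 3).sqrt
  rw [Real.sqrt_zero] at h
  refine h.congr fun T => ?_
  rw [← Real.sqrt_sq (show 0 ≤ (windowEnd κ T : ℝ) ^ 3 / ((T / 2 : ℕ) : ℝ) ^ 2 by positivity)]
  congr 1
  rw [div_pow, div_div, ← pow_succ, div_pow, ← pow_mul, ← pow_mul, ← pow_mul]

theorem eventually_windowEnd_lt_half {κ : ℝ} (hκ : 0 < κ) :
    ∀ᶠ T : ℕ in atTop, windowEnd κ T < T / 2 := by
  filter_upwards [(tendsto_windowEnd_div_half hκ).eventually_lt_const one_pos,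
    eventually_ge_atTop 2] with T h hT
  have hn : (0 : ℝ) < (T / 2 : ℕ) := by exact_mod_cast (by omega : 0 < T / 2)
  exact_mod_cast (div_lt_one hn).1 h

theorem tendsto_windowEnd_sq_div_half_sub_windowEnd_sub {κ : ℝ} (hκ : 0 < κ) :
    Tendsto (fun T : ℕ => (windowEnd κ T : ℝ) ^ 2 / ((T / 2 : ℕ) - windowEnd κ T) - logFactor κ T)
      atTop (𝓝 2) := by
  have h := (tendsto_windowEnd_sq_div_half_sub hκ).add
    ((tendsto_windowEnd_pow_three_div_half_sq hκ).div
      ((tendsto_windowEnd_div_half hκ).const_sub 1) (by norm_num))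
  rw [zero_div, add_zero] at h
  refine h.congr' ?_
  filter_upwards [eventually_windowEnd_lt_half hκ] with T hT
  have hn : (0 : ℝ) < (T / 2 : ℕ) := by exact_mod_cast pos_of_gt hT
  have hsub : (0 : ℝ) < (T / 2 : ℕ) - windowEnd κ T := sub_pos.2 (by exact_mod_cast hT)
  rw [Pi.div_apply, one_sub_div hn.ne']
  field_simp
  ring

theorem tendsto_windowLength_sq_div_sqrt_half_mul_exp {κ : ℝ} (hκ : 0 < κ) :
    Tendsto (fun T : ℕ => (windowLength T : ℝ) ^ 2 / √(T / 2 : ℕ) * Real.exp (-logFactor κ T))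
      atTop (𝓝 (√2 / κ)) := by
  have h := ((tendsto_windowLength_div.pow 2).mul tendsto_natCast_div_half.sqrt).div_const κ
  rw [one_pow, one_mul] at h
  refine h.congr' ?_
  filter_upwards [tendsto_log_natCast_atTop.eventually_gt_atTop 0, eventually_gt_atTop 0]
    with T hlog hT
  have hT' : (0 : ℝ) < T := by exact_mod_cast hT
  rw [Real.exp_neg, exp_logFactor hκ hT hlog, div_pow, Real.sq_sqrt (by positivity),
    Real.sqrt_div hT'.le]
  have hss : √(T : ℝ) ^ 2 = T := Real.sq_sqrt hT'.le
  field_simp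
  rw [hss]

theorem tendsto_windowLength_sq_mul_exp {κ : ℝ} (hκ : 0 < κ) :
    Tendsto (fun T : ℕ => (windowLength T : ℝ) ^ 2 / √(T / 2 : ℕ) *
      Real.exp (-((windowEnd κ T : ℝ) ^ 2 / ((T / 2 : ℕ) - windowEnd κ T)))) atTop
      (𝓝 (√2 / κ * Real.exp (-2))) := by
  refine ((tendsto_windowLength_sq_div_sqrt_half_mul_exp hκ).mul
    (tendsto_windowEnd_sq_div_half_sub_windowEnd_sub hκ).neg.rexp).congr fun T => ?_
  rw [mul_assoc, ← Real.exp_add]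
  ring_nf

theorem eventually_forall_exists_regret_gt {U ε κ : ℝ} (hU : 0 ≤ U) (hκ : 0 < κ)
    (hε : ε < U * (√2 / κ * Real.exp (-2))) :
    ∀ᶠ T : ℕ in atTop, ∀ d : ℕ, 0 < d → ∀ A : OLO.Algorithm d,
      (∀ adv : OLO.Adversary d, OLO.regret A adv T 0 ≤ ε) →
      ∃ (adv : OLO.Adversary d) (u : OLO.Point d), ‖u‖ = U ∧
        U * √(2 * T * logFactor κ T) + ε < OLO.regret A adv T u := by
  filter_upwards [eventually_windowEnd_lt_half hκ,
    ((tendsto_windowLength_sq_mul_exp hκ).const_mul U).eventually_const_lt hε] with T hend hexc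
  intro d hd A hA
  refine OLO.exists_regret_gt_of_lt_window hd A (Nat.mul_div_le T 2) hend hU ?_ hA ?_
  · gcongr
    exact sqrt_two_mul_logFactor_le κ T
  · rwa [mul_assoc]

theorem logFactor_mul_exp_neg {κ : ℝ} (hκ : 0 < κ) (α : ℝ) {T : ℕ} (hT : 0 < T)
    (hlog : 0 < Real.log T) : logFactor (κ * Real.exp (-α)) T = logFactor κ T - α := by
  have harg : κ * Real.exp (-α) * √T / Real.log T = κ * √T / Real.log T * Real.exp (-α) := by ring
  rw [logFactor, harg, Real.log_mul (by positivity) (Real.exp_ne_zero _), Real.log_exp, logFactor,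
    sub_eq_add_neg]

theorem tendsto_logFactor_sub_sq_mul {κ : ℝ} (hκ : 0 < κ) (η : ℝ) :
    Tendsto (fun T : ℕ => logFactor κ T - (1 - η * (Real.log T)⁻¹) ^ 2 * logFactor κ T) atTop
      (𝓝 η) := by
  have h := (tendsto_logFactor_div_log hκ).mul
    ((tendsto_log_natCast_atTop.inv_tendsto_atTop.const_mul (η ^ 2)).const_sub (2 * η))
  rw [mul_zero, sub_zero, one_div, inv_mul_cancel_left₀ two_ne_zero] at h
  refine h.congr fun T => ?_
  rw [Pi.inv_apply]
  ring

theorem eventually_one_sub_mul_sqrt_logFactor_le {α η κ : ℝ} (hα : α < η) (hκ : 0 < κ) :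
    ∀ᶠ T : ℕ in atTop, (1 - η * (Real.log T)⁻¹) * √(2 * T * logFactor κ T) ≤
      √(2 * T * logFactor (κ * Real.exp (-α)) T) := by
  filter_upwards [(tendsto_logFactor_sub_sq_mul hκ η).eventually_const_lt hα,
    tendsto_log_natCast_atTop.eventually_gt_atTop 0, eventually_gt_atTop 0,
    eventually_logFactor_pos hκ] with T hα hlog hT hL
  rw [logFactor_mul_exp_neg hκ α hT hlog]
  refine Real.le_sqrt_of_sq_le ?_
  rw [mul_pow, Real.sq_sqrt (by positivity), mul_left_comm]
  gcongr
  linarith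

theorem exp_three_halves_lt_two_mul_sqrt_two_mul_sqrt_pi :
    Real.exp (3 / 2) < 2 * √2 * √Real.pi := by
  rw [mul_assoc, ← Real.sqrt_mul two_pos.le, ← pow_lt_pow_iff_left₀ (by positivity)
    (by positivity) two_ne_zero, mul_pow, Real.sq_sqrt (by positivity), ← Real.exp_nat_mul]
  calc Real.exp ((2 : ℕ) * (3 / 2)) = Real.exp 1 ^ 3 := by rw [← Real.exp_nat_mul]; norm_num
    _ < 2.72 ^ 3 := by gcongr; linarith [Real.exp_one_lt_d9]
    _ < 2 ^ 2 * (2 * Real.pi) := by linarith [Real.pi_gt_three]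

/-- With the exponent `η - δ` the worst case is `η = 1`, where the inequality reads
`exp (1 + δ) < √(8 π)`; the value `δ = 1 / 2` leaves room. -/
theorem mul_sqrt_exp_one_lt {C η U : ℝ} (hC : 0 < C) (hη : 0 < η) (hU : 0 < U) :
    C * √(Real.exp 1) <
      U * (√2 / (η * U / (2 * √(Real.pi * Real.exp 1) * C) * Real.exp (-(η - 1 / 2))) *
        Real.exp (-2)) := by
  have hden : η * (Real.exp (-(η - 1 / 2)) * Real.exp 2) < 2 * √2 * √Real.pi :=
    calc η * (Real.exp (-(η - 1 / 2)) * Real.exp 2)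
        ≤ Real.exp (η - 1) * (Real.exp (-(η - 1 / 2)) * Real.exp 2) := by
          gcongr
          linarith [Real.add_one_le_exp (η - 1)]
      _ = Real.exp (3 / 2) := by rw [← Real.exp_add, ← Real.exp_add]; ring_nf
      _ < _ := exp_three_halves_lt_two_mul_sqrt_two_mul_sqrt_pi
  calc C * √(Real.exp 1)
      < C * √(Real.exp 1) *
          (2 * √2 * √Real.pi / (η * (Real.exp (-(η - 1 / 2)) * Real.exp 2))) :=
        lt_mul_of_one_lt_right (by positivity) ((one_lt_div (by positivity)).2 hden)
    _ = _ := by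
        rw [Real.sqrt_mul Real.pi_pos.le, Real.exp_neg 2]
        field_simp

theorem mainTheorem8_general {C η U : ℝ} (hC : 0 < C) (hη : 0 < η) (hU : 0 < U) :
    ∃ T₀ : ℕ, 0 < T₀ ∧
      ∀ d : ℕ, 0 < d → ∀ T : ℕ, T₀ ≤ T → ∀ A : OLO.Algorithm d,
        (∀ adv : OLO.Adversary d, OLO.regret A adv T 0 ≤ C * √(Real.exp 1)) →
        ∃ (adv : OLO.Adversary d) (u : OLO.Point d), ‖u‖ = U ∧
          OLO.regret A adv T u ≥
            (1 - η * (Real.log T)⁻¹) * ‖u‖ *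
              √(2 * T * Real.log
                (η * ‖u‖ * √(T : ℝ) / (2 * √(Real.pi * Real.exp 1) * C * Real.log T))) := by
  have hκ : 0 < η * U / (2 * √(Real.pi * Real.exp 1) * C) := by positivity
  obtain ⟨T₀, hT₀⟩ := eventually_atTop.1
    ((eventually_forall_exists_regret_gt hU.le (mul_pos hκ (Real.exp_pos _))
      (mul_sqrt_exp_one_lt hC hη hU)).and
    (eventually_one_sub_mul_sqrt_logFactor_le (sub_lt_self η one_half_pos) hκ))
  refine ⟨T₀ + 1, T₀.succ_pos, fun d hd T hT A hA => ?_⟩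
  obtain ⟨hgame, habsorb⟩ := hT₀ T (by omega)
  obtain ⟨adv, u, rfl, hreg⟩ := hgame d hd A hA
  refine ⟨adv, u, rfl, ?_⟩
  rw [logFactor, div_mul_eq_mul_div, div_div] at habsorb
  calc _ = ‖u‖ * ((1 - η * (Real.log T)⁻¹) * √(2 * T * Real.log
          (η * ‖u‖ * √(T : ℝ) / (2 * √(Real.pi * Real.exp 1) * C * Real.log T)))) := by ring
    _ ≤ ‖u‖ * √(2 * T * logFactor _ T) := by gcongr
    _ ≤ _ := (le_add_of_nonneg_right (by positivity)).trans hreg.le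

theorem mainTheorem8 (C η U : ℝ) (hC : 0 < C) (hη : η ∈ Set.Ioo (0 : ℝ) 1)
    (hU : 12 * η⁻¹ * C ≤ U) :
    ∃ T₀ : ℕ, 0 < T₀ ∧
      ∀ d : ℕ, 0 < d → ∀ T : ℕ, T₀ ≤ T → ∀ A : OLO.Algorithm d,
        (∀ adv : OLO.Adversary d, OLO.regret A adv T 0 ≤ C * √(Real.exp 1)) →
        ∃ (adv : OLO.Adversary d) (u : OLO.Point d), ‖u‖ = U ∧
          OLO.regret A adv T u ≥
            (1 - η * (Real.log T)⁻¹) * ‖u‖ *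
              √(2 * T * Real.log
                (η * ‖u‖ * √(T : ℝ) / (2 * √(Real.pi * Real.exp 1) * C * Real.log T))) := by
  have hη0 : 0 < η := hη.1
  exact mainTheorem8_general hC hη0 (lt_of_lt_of_le (by positivity) hU)
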